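/- Let $k\ge 1$ and write $[k]=\{1,\dots,k\}$. A \emph{$k$-configuration} is a map $\chi\colon \mathcal{P}([k])\setminus\{\varnothing\}\to\{0,1\}$. For a group $G$ and a family $\mathcal{H}=(H_1,\dots,H_k)$ of $k$ subgroups of $G$ (with possible repetitions), write $H_I=\bigcap_{i\in I}H_i$ for every nonempty $I\subseteq[k]$, and let $\chi^{\mathcal{H}}$ be the $k$-configuration with $\chi^{\mathcal{H}}(I)=0$ if $H_I$ is finitely generated and $\chi^{\mathcal{H}}(I)=1$ otherwise. A $k$-configuration $\chi$ is \emph{realizable in $G$} if $\chi=\chi^{\mathcal{H}}$ for some family $\mathcal{H}$ of $k$ subgroups of $G$. A $k$-configuration $\chi$ is \emph{Howson} if, for all nonempty $I,J\subseteq[k]$, $\chi(I)=\chi(J)=0$ implies $\chi(I\cup J)=0$. \textbf{Theorem.} Let $n\ge 2$ be an integer, let $F_n$ be the free group of rank $n$, and let $k\ge 1$. A $k$-configuration is realizable in $F_n$ if and only if it is Howson. -/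

import Mathlib

/-- The nonempty subsets of `[k]`, with `[k]` modelled by `Fin k`. -/
abbrev NonemptySubset (k : ℕ) : Type := {I : Finset (Fin k) // I.Nonempty}

/-- The union of two nonempty subsets of `[k]`, again a nonempty subset. -/
def NonemptySubset.union {k : ℕ} (I J : NonemptySubset k) : NonemptySubset k :=
  ⟨I.1 ∪ J.1, I.2.mono Finset.subset_union_left⟩

/-- A `k`-configuration: a map from the nonempty subsets of `[k]` to `{0, 1}`. -/
abbrev Configuration (k : ℕ) : Type := NonemptySubset k → Fin 2

/-- The intersection `H_I = ⋂_{i ∈ I} H_i` of the members of a family indexed by `I`. -/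
def familyInter {G : Type*} [Group G] {k : ℕ} (H : Fin k → Subgroup G)
    (I : NonemptySubset k) : Subgroup G :=
  ⨅ i ∈ I.1, H i

open Classical in
/-- The intersection configuration determined by a family of `k` subgroups: it sends `I` to `0`
if `H_I` is finitely generated, and to `1` otherwise. -/
noncomputable def intersectionConfiguration {G : Type*} [Group G] {k : ℕ}
    (H : Fin k → Subgroup G) : Configuration k :=
  fun I => if (familyInter H I).FG then 0 else 1

/-- A `k`-configuration is realizable in `G` if it is the intersection configuration of some
family of `k` subgroups of `G`. -/
def Configuration.IsRealizable {k : ℕ} (c : Configuration k) (G : Type*) [Group G] : Prop :=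
  ∃ H : Fin k → Subgroup G, intersectionConfiguration H = c

/-- A `k`-configuration is Howson if `c (I ∪ J) = 0` whenever `c I = c J = 0`. -/
def Configuration.IsHowson {k : ℕ} (c : Configuration k) : Prop :=
  ∀ I J : NonemptySubset k, c I = 0 → c J = 0 → c (I.union J) = 0

/-! # Intersection configurations of free groups

*Realizable implies Howson.* The configuration of any family satisfies the Howson condition as soon
as the intersection of two finitely generated subgroups is finitely generated. For a subgroup `H`
of a free group, consider the set `Subgroup.core H` of the cosets `u⁻¹ H`, where `u` runs over the
prefixes of the reduced words of the elements of `H`; these cosets are the vertices of the Stallings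
core graph of `H`. Over a finite alphabet, `H` is finitely generated if and only if `core H` is
finite (`Subgroup.fg_iff_finite_core`). Since `core (H ⊓ K)` embeds in `core H × core K`, Howson's
theorem follows (`Subgroup.FG.inf_of_freeGroup`).

*Howson implies realizable.* If `c` is Howson and `c I = 1`, then `I` has an element `i` such that
`c J = 1` for all `J` with `i ∈ J ⊆ I`: otherwise `I` would be a union of sets of value `0`
(`Configuration.IsHowson.exists_pivot`). Hence `c` is the maximum of the configurations that are `1`
exactly on `{J | i ∈ J ⊆ I}`, for the pairs `(i, I)` with this property. The configuration of one
such pair is realized by a subgroup `N` that is not finitely generated at `i`, the whole group at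
the other elements of `I`, and the trivial subgroup outside `I`. Maxima are realized in free
products: the free product of subgroups of the factors commutes with intersections, by the normal
form, and it is finitely generated if and only if all its factors are (`freeProd_iInf`,
`freeProd_fg_iff`). Finally, the free product of finitely many free groups of finite rank is a
free group of finite rank, which embeds in `F_n`: the elements `aⁱ b a⁻ⁱ` are a free family
(`FreeGroup.conjHom_injective`). -/

/-! ### Finite generation and homomorphisms -/

theorem Subgroup.FG.map_hom {G G' : Type*} [Group G] [Group G'] {H : Subgroup G} (h : H.FG)
    (f : G →* G') : (H.map f).FG := by
  classical
  obtain ⟨S, rfl⟩ := h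
  exact ⟨S.image f, by rw [Finset.coe_image, MonoidHom.map_closure]⟩

theorem Subgroup.fg_map_iff {G G' : Type*} [Group G] [Group G'] {H : Subgroup G} {f : G →* G'}
    (hf : Function.Injective f) : (H.map f).FG ↔ H.FG := by
  refine ⟨fun h => ?_, fun h => h.map_hom f⟩
  rw [Subgroup.fg_iff_submonoid_fg] at h ⊢
  exact Submonoid.FG.map_injective f hf h

/-- A finitely generated group has only finitely many homomorphisms to the group of order two,
whereas a free group of infinite rank has infinitely many. -/
theorem FreeGroup.not_fg_of_infinite (α : Type*) [Infinite α] : ¬ Group.FG (FreeGroup α) := by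
  classical
  rintro ⟨S, hS⟩
  have hfin : Finite (FreeGroup α →* Multiplicative (ZMod 2)) := by
    refine Finite.of_injective (β := S → Multiplicative (ZMod 2)) (fun f s => f s) fun f g h => ?_
    exact MonoidHom.eq_of_eqOn_dense hS fun s hs => congrFun h ⟨s, hs⟩
  have : Finite (α → Multiplicative (ZMod 2)) := Finite.of_equiv _ FreeGroup.lift.symm
  refine not_finite (α → Multiplicative (ZMod 2))

/-! ### The core of a subgroup of a free group and Howson's theorem -/

theorem List.IsPrefix.of_append {β : Type*} {u L₁ L₂ : List β} (h : u <+: L₁ ++ L₂) :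
    u <+: L₁ ∨ ∃ v, u = L₁ ++ v ∧ v <+: L₂ := by
  obtain ⟨t, ht⟩ := h
  rcases List.append_eq_append_iff.1 ht with ⟨v, rfl, -⟩ | ⟨v, rfl, rfl⟩
  · exact Or.inl (List.prefix_append _ _)
  · exact Or.inr ⟨v, rfl, List.prefix_append _ _⟩

/-- Reducing a word creates no new vertex on the path that it labels in the Cayley graph. -/
theorem FreeGroup.Red.exists_prefix {α : Type*} {L L' : List (α × Bool)} (h : FreeGroup.Red L L')
    {u : List (α × Bool)} (hu : u <+: L') : ∃ u', u' <+: L ∧ FreeGroup.mk u' = FreeGroup.mk u := by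
  induction h generalizing u with
  | refl => exact ⟨u, hu, rfl⟩
  | tail _ hs ih =>
    cases hs with
    | @not L₁ L₂ x b =>
      rcases hu.of_append with hu | ⟨v, rfl, hv⟩
      · exact ih (hu.trans (List.prefix_append _ _))
      · obtain ⟨u', h1, h2⟩ := ih (u := L₁ ++ (x, b) :: (x, !b) :: v) (by simpa using hv)
        exact ⟨u', h1, h2.trans (Quot.sound FreeGroup.Red.Step.not)⟩

section Core

variable {α : Type*} [DecidableEq α]

/-- The vertices of the Stallings core graph of `H`. They are the right cosets `H u`, for `u` a
prefix of the reduced word of an element of `H`, encoded by inversion as left cosets `u⁻¹ H`. -/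
def Subgroup.core (H : Subgroup (FreeGroup α)) : Set (FreeGroup α ⧸ H) :=
  {x | ∃ h ∈ H, ∃ u, u <+: FreeGroup.toWord h ∧ x = ((FreeGroup.mk u)⁻¹ : FreeGroup α)}

theorem Subgroup.FG.finite_core {H : Subgroup (FreeGroup α)} (hH : H.FG) : H.core.Finite := by
  rw [Subgroup.fg_iff_submonoid_fg] at hH
  obtain ⟨S, hS⟩ := hH
  -- The vertices on the loops labelled by the generators.
  let C : Set (FreeGroup α ⧸ H) := insert ((1 : FreeGroup α) : FreeGroup α ⧸ H)
    (⋃ s ∈ S, (fun u => (((FreeGroup.mk u)⁻¹ : FreeGroup α) : FreeGroup α ⧸ H)) ''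
      {u | u ∈ s.toWord.inits})
  have hC : C.Finite :=
    (S.finite_toSet.biUnion fun s _ => (List.finite_toSet _).image _).insert _
  refine hC.subset ?_
  rintro _ ⟨h, hh, u, hu, rfl⟩
  rw [← Subgroup.mem_toSubmonoid, ← hS] at hh
  induction hh using Submonoid.closure_induction generalizing u with
  | mem s hs =>
    refine Set.mem_insert_of_mem _ (Set.mem_biUnion hs ⟨u, ?_, rfl⟩)
    simpa using hu
  | one =>
    rw [FreeGroup.toWord_one, List.prefix_nil] at hu
    subst hu
    exact Set.mem_insert_iff.2 (Or.inl (by rw [← FreeGroup.one_eq_mk, inv_one]))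
  | mul x y hx _ ihx ihy =>
    rw [FreeGroup.toWord_mul] at hu
    obtain ⟨u', hu', he⟩ := FreeGroup.reduce.red.exists_prefix hu
    rw [← he]
    rcases hu'.of_append with hu' | ⟨v, rfl, hv⟩
    · exact ihx _ hu'
    · rw [hS, Subgroup.mem_toSubmonoid] at hx
      have hxv : (((FreeGroup.mk (x.toWord ++ v))⁻¹ : FreeGroup α) : FreeGroup α ⧸ H) =
          ((FreeGroup.mk v)⁻¹ : FreeGroup α) := by
        rw [QuotientGroup.eq, ← FreeGroup.mul_mk, FreeGroup.mk_toWord]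
        simpa only [inv_inv, mul_inv_cancel_right] using hx
      rw [hxv]
      exact ihy _ hv

/-- The generators come from the edges `H u → H u x` of the core graph, closed up by fixed
representatives `r` of the vertices. -/
theorem Subgroup.fg_of_finite_core [Finite α] {H : Subgroup (FreeGroup α)} (hH : H.core.Finite) :
    H.FG := by
  let r : FreeGroup α ⧸ H → FreeGroup α := fun x => x.out⁻¹
  have hr : ∀ g : FreeGroup α, g * (r ((g⁻¹ : FreeGroup α) : FreeGroup α ⧸ H))⁻¹ ∈ H := fun g => by
    have := QuotientGroup.eq.1 (QuotientGroup.out_eq' ((g⁻¹ : FreeGroup α) : FreeGroup α ⧸ H)).symm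
    simpa [r] using this
  let S : Set (FreeGroup α) := insert (r ((1 : FreeGroup α) : FreeGroup α ⧸ H))
    ((fun p : ((FreeGroup α ⧸ H) × (FreeGroup α ⧸ H)) × (α × Bool) =>
      r p.1.1 * FreeGroup.mk [p.2] * (r p.1.2)⁻¹) '' ((H.core ×ˢ H.core) ×ˢ Set.univ) ∩ H)
  have hSfin : S.Finite :=
    ((((hH.prod hH).prod Set.finite_univ).image _).inter_of_left _).insert _
  have h1 : r ((1 : FreeGroup α) : FreeGroup α ⧸ H) ∈ H := by
    simpa using hr 1
  have h1S : r ((1 : FreeGroup α) : FreeGroup α ⧸ H) ∈ Subgroup.closure S :=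
    Subgroup.subset_closure (Set.mem_insert _ _)
  rw [Subgroup.fg_iff]
  refine ⟨S, le_antisymm ?_ fun h hh => ?_, hSfin⟩
  · rw [Subgroup.closure_le]
    exact Set.insert_subset h1 Set.inter_subset_right
  have key : ∀ u : List (α × Bool), u <+: h.toWord → FreeGroup.mk u *
      (r (((FreeGroup.mk u)⁻¹ : FreeGroup α) : FreeGroup α ⧸ H))⁻¹ ∈ Subgroup.closure S := by
    intro u
    induction u using List.reverseRecOn with
    | nil =>
      intro _
      rw [← FreeGroup.one_eq_mk, one_mul, inv_one]
      exact inv_mem h1S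
    | append_singleton u p ih =>
      intro hu
      have hu' : u <+: h.toWord := (List.prefix_append _ _).trans hu
      have hp := ih hu'
      set c : FreeGroup α ⧸ H := (((FreeGroup.mk u)⁻¹ : FreeGroup α) : FreeGroup α ⧸ H) with hc
      set c' : FreeGroup α ⧸ H :=
        (((FreeGroup.mk (u ++ [p]))⁻¹ : FreeGroup α) : FreeGroup α ⧸ H)
      have hsplit : FreeGroup.mk (u ++ [p]) * (r c')⁻¹ =
          (FreeGroup.mk u * (r c)⁻¹) * (r c * FreeGroup.mk [p] * (r c')⁻¹) := by
        rw [← FreeGroup.mul_mk]; group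
      have hmem : r c * FreeGroup.mk [p] * (r c')⁻¹ ∈ H := by
        rw [← Subgroup.mul_mem_cancel_left H (hr (FreeGroup.mk u)), ← hc, ← hsplit]
        exact hr _
      rw [hsplit]
      refine mul_mem hp (Subgroup.subset_closure (Set.mem_insert_of_mem _ ⟨?_, hmem⟩))
      exact ⟨((c, c'), p), ⟨⟨⟨h, hh, u, hu', rfl⟩, ⟨h, hh, _, hu, rfl⟩⟩, trivial⟩, rfl⟩
  have hfin := key _ List.prefix_rfl
  have hcos : ((h⁻¹ : FreeGroup α) : FreeGroup α ⧸ H) = (1 : FreeGroup α) := by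
    rw [QuotientGroup.eq]; simpa using hh
  rw [FreeGroup.mk_toWord, hcos] at hfin
  simpa using mul_mem hfin h1S

theorem Subgroup.fg_iff_finite_core [Finite α] {H : Subgroup (FreeGroup α)} :
    H.FG ↔ H.core.Finite :=
  ⟨Subgroup.FG.finite_core, Subgroup.fg_of_finite_core⟩

/-- **Howson's theorem**. -/
theorem Subgroup.FG.inf_of_freeGroup [Finite α] {H K : Subgroup (FreeGroup α)} (hH : H.FG)
    (hK : K.FG) : (H ⊓ K).FG := by
  rw [Subgroup.fg_iff_finite_core] at *
  let f : FreeGroup α ⧸ (H ⊓ K) → (FreeGroup α ⧸ H) × (FreeGroup α ⧸ K) := fun x =>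
    (Subgroup.quotientMapOfLE inf_le_left x, Subgroup.quotientMapOfLE inf_le_right x)
  have hf : Function.Injective f := by
    intro x y
    induction x using QuotientGroup.induction_on
    induction y using QuotientGroup.induction_on
    intro h
    simp only [f, Subgroup.quotientMapOfLE_apply_mk, Prod.mk.injEq] at h
    exact QuotientGroup.eq.2 ⟨QuotientGroup.eq.1 h.1, QuotientGroup.eq.1 h.2⟩
  refine ((hH.prod hK).preimage hf.injOn).subset ?_
  rintro _ ⟨h, hh, u, hu, rfl⟩
  exact ⟨⟨h, hh.1, u, hu, rfl⟩, ⟨h, hh.2, u, hu, rfl⟩⟩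

end Core

/-! ### Free products of subgroups -/

section FreeProd

open Monoid

variable {ι : Type*} {G : ι → Type*} [∀ i, Group (G i)]

/-- The subgroup of a free product generated by given subgroups of the factors; it is their free
product. -/
def freeProd (A : ∀ i, Subgroup (G i)) : Subgroup (CoprodI G) :=
  ⨆ i, (A i).map CoprodI.of

/-- Membership in `freeProd A` is read off the normal form: a reduced word with letters in the
subgroups `A i` is also reduced in the ambient free product. -/
theorem mem_freeProd_iff [DecidableEq ι] [∀ i, DecidableEq (G i)] {A : ∀ i, Subgroup (G i)}
    {g : CoprodI G} : g ∈ freeProd A ↔ ∀ l ∈ (CoprodI.Word.equiv g).toList, l.2 ∈ A l.1 := by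
  constructor
  · intro hg
    have hg' : g ∈ (CoprodI.lift fun i => (CoprodI.of (M := G)).comp (A i).subtype).range := by
      rw [CoprodI.range_eq_iSup]
      simpa only [MonoidHom.range_comp, Subgroup.range_subtype, freeProd] using hg
    obtain ⟨x, rfl⟩ := hg'
    obtain ⟨w, rfl⟩ := CoprodI.Word.equiv.symm.surjective x
    let w' : CoprodI.Word G :=
      { toList := w.toList.map fun l => ⟨l.1, (l.2 : G l.1)⟩
        ne_one := by
          intro l hl
          obtain ⟨m, hm, rfl⟩ := List.mem_map.1 hl
          exact fun h => w.ne_one m hm (Subtype.ext h)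
        chain_ne := by
          rw [List.isChain_map]
          exact w.chain_ne }
    have hw' : CoprodI.lift (fun i => (CoprodI.of (M := G)).comp (A i).subtype)
        (CoprodI.Word.equiv.symm w) = CoprodI.Word.equiv.symm w' := by
      change CoprodI.lift _ w.prod = w'.prod
      simp only [CoprodI.Word.prod, w', map_list_prod, List.map_map]
      congr 1
    rw [hw', Equiv.apply_symm_apply]
    intro l hl
    obtain ⟨m, _, rfl⟩ := List.mem_map.1 hl
    exact m.2.2
  · intro h
    rw [← CoprodI.Word.equiv.symm_apply_apply g]
    refine Subgroup.list_prod_mem _ fun x hx => ?_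
    obtain ⟨l, hl, rfl⟩ := List.mem_map.1 hx
    exact Subgroup.mem_iSup_of_mem l.1 (Subgroup.mem_map_of_mem _ (h l hl))

theorem freeProd_iInf {κ : Type*} (s : Finset κ) (A : κ → ∀ i, Subgroup (G i)) :
    freeProd (fun i => ⨅ j ∈ s, A j i) = ⨅ j ∈ s, freeProd (A j) := by
  classical
  ext g
  simp only [mem_freeProd_iff, Subgroup.mem_iInf]
  exact ⟨fun h j hj l hl => h l hl j hj, fun h l hl j hj => h j hj l hl⟩

/-- Each factor is the image of the free product under the retraction that kills the others. -/
theorem freeProd_fg_iff [Finite ι] {A : ∀ i, Subgroup (G i)} :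
    (freeProd A).FG ↔ ∀ i, (A i).FG := by
  classical
  refine ⟨fun h i => ?_, fun h => Subgroup.FG.iSup _ fun i => (h i).map_hom _⟩
  convert h.map_hom (CoprodI.lift <| Pi.mulSingle i (MonoidHom.id (G i)))
  refine le_antisymm ?_ ?_
  · intro x hx
    refine ⟨CoprodI.of x, Subgroup.mem_iSup_of_mem i (Subgroup.mem_map_of_mem _ hx), ?_⟩
    exact CoprodI.of_leftInverse i x
  · rw [Subgroup.map_le_iff_le_comap, freeProd, iSup_le_iff]
    intro j
    rw [Subgroup.map_le_iff_le_comap]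
    intro x hx
    rw [Subgroup.mem_comap, Subgroup.mem_comap, CoprodI.lift_of]
    obtain rfl | hij := eq_or_ne i j
    · simpa using hx
    · rw [Pi.mulSingle_eq_of_ne' hij]
      exact one_mem _

end FreeProd

/-! ### A free group of infinite rank inside a free group of rank two -/

namespace FreeGroup

/-- The action of `ℤ` on the free group with basis `ℤ` that translates the basis. -/
def shift : Multiplicative ℤ →* MulAut (FreeGroup ℤ) where
  toFun m := freeGroupCongr (Equiv.addLeft m.toAdd)
  map_one' := by
    ext x
    simp
  map_mul' m m' := by
    ext x
    simp only [freeGroupCongr_apply, MulAut.mul_apply, map.comp]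
    congr 2
    ext i
    simp

variable {α : Type*}

/-- The homomorphism from the free group with basis `ℤ` that sends `i` to `aⁱ b a⁻ⁱ`. -/
def conjHom (a b : α) : FreeGroup ℤ →* FreeGroup α :=
  lift fun i => of a ^ i * of b * (of a ^ i)⁻¹

/-- Sending `a` to the generator of `ℤ` and `b` to the basis element `0` defines a homomorphism to
`FreeGroup ℤ ⋊ ℤ`, and its composite with `conjHom a b` is the inclusion of `FreeGroup ℤ`. -/
theorem conjHom_injective {a b : α} (hab : a ≠ b) : Function.Injective (conjHom a b) := by
  classical
  let ψ : FreeGroup α →* FreeGroup ℤ ⋊[shift] Multiplicative ℤ :=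
    lift fun x => if x = a then SemidirectProduct.inr (Multiplicative.ofAdd 1)
      else SemidirectProduct.inl (of 0)
  have h : ψ.comp (conjHom a b) = SemidirectProduct.inl := by
    ext1 i
    have hi : (Multiplicative.ofAdd (1 : ℤ)) ^ i = Multiplicative.ofAdd i := by
      rw [← ofAdd_zsmul]; simp
    simp only [MonoidHom.comp_apply, conjHom, lift_apply_of, ψ, _root_.map_mul, _root_.map_inv,
      _root_.map_zpow, if_true, if_neg hab.symm]
    rw [← _root_.map_zpow, hi, ← _root_.map_inv, ← SemidirectProduct.inl_aut]
    simp [shift]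
  have hinj : Function.Injective (ψ.comp (conjHom a b)) := by
    rw [h]; exact SemidirectProduct.inl_injective
  exact Function.Injective.of_comp hinj

theorem not_fg_range_conjHom {a b : α} (hab : a ≠ b) : ¬ (conjHom a b).range.FG := by
  rw [MonoidHom.range_eq_map, Subgroup.fg_map_iff (conjHom_injective hab), ← Group.fg_def]
  exact not_fg_of_infinite ℤ

/-- A free product of countably many copies of a free group of countable rank embeds in any free
group of rank at least two. -/
theorem exists_injective_coprodI_hom {a b : α} (hab : a ≠ b) (T β : Type*) [Countable T]
    [Countable β] : ∃ f : Monoid.CoprodI (fun _ : T => FreeGroup β) →* FreeGroup α,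
      Function.Injective f := by
  obtain ⟨e, he⟩ := exists_injective_nat (Σ _ : T, β)
  let B := Monoid.CoprodI.FreeGroupBasis.coprodI fun _ : T => FreeGroupBasis.ofFreeGroup β
  refine ⟨(conjHom a b).comp ((map fun x => (e x : ℤ)).comp B.repr.toMonoidHom), ?_⟩
  exact (conjHom_injective hab).comp
    ((map_injective (Nat.cast_injective.comp he)).comp B.repr.injective)

end FreeGroup

/-! ### Configurations -/

theorem intersectionConfiguration_eq_zero_iff {G : Type*} [Group G] {k : ℕ}
    {H : Fin k → Subgroup G} {I : NonemptySubset k} :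
    intersectionConfiguration H I = 0 ↔ (familyInter H I).FG := by
  unfold intersectionConfiguration
  split_ifs with h <;> simp [h]

theorem intersectionConfiguration_eq_iff {G : Type*} [Group G] {k : ℕ}
    {H : Fin k → Subgroup G} {c : Configuration k} :
    intersectionConfiguration H = c ↔ ∀ I, (familyInter H I).FG ↔ c I = 0 := by
  simp only [← intersectionConfiguration_eq_zero_iff, funext_iff]
  refine forall_congr' fun I => ?_
  lia

theorem familyInter_union {G : Type*} [Group G] {k : ℕ} (H : Fin k → Subgroup G)
    (I J : NonemptySubset k) : familyInter H (I.union J) = familyInter H I ⊓ familyInter H J := by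
  simp only [familyInter, NonemptySubset.union, Finset.iInf_union]

theorem Configuration.IsRealizable.of_injective {G G' : Type*} [Group G] [Group G'] {k : ℕ}
    {c : Configuration k} (hc : c.IsRealizable G) {f : G →* G'} (hf : Function.Injective f) :
    c.IsRealizable G' := by
  obtain ⟨H, hH⟩ := hc
  refine ⟨fun i => (H i).map f, ?_⟩
  rw [intersectionConfiguration_eq_iff] at hH ⊢
  intro I
  rw [← hH I, ← Subgroup.fg_map_iff hf]
  -- The index set `I` is nonempty, so that `map f` commutes with the intersection.
  have : Nonempty {i // i ∈ I.1} := I.2.to_subtype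
  simp only [familyInter, iInf_subtype', Subgroup.map_iInf f hf]

/-- If `c I = 1` for a Howson configuration `c`, some `i ∈ I` lies in no `J ⊆ I` with `c J = 0`. -/
theorem Configuration.IsHowson.exists_pivot {k : ℕ} {c : Configuration k} (hc : c.IsHowson)
    {I : NonemptySubset k} (hI : c I ≠ 0) :
    ∃ i ∈ I.1, ∀ J : NonemptySubset k, i ∈ J.1 → J.1 ⊆ I.1 → c J ≠ 0 := by
  by_contra! h
  have key : ∀ s : Finset (Fin k), s.Nonempty → s ⊆ I.1 →
      ∃ K : NonemptySubset k, s ⊆ K.1 ∧ K.1 ⊆ I.1 ∧ c K = 0 := by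
    intro s hs
    induction hs using Finset.Nonempty.cons_induction with
    | singleton i =>
      intro hi
      obtain ⟨J, h1, h2, h3⟩ := h i (Finset.singleton_subset_iff.1 hi)
      exact ⟨J, Finset.singleton_subset_iff.2 h1, h2, h3⟩
    | cons i s hi hs ih =>
      intro hsub
      rw [Finset.cons_eq_insert, Finset.insert_subset_iff] at hsub
      obtain ⟨J, h1, h2, h3⟩ := h i hsub.1
      obtain ⟨K, k1, k2, k3⟩ := ih hsub.2
      refine ⟨J.union K, ?_, Finset.union_subset h2 k2, hc J K h3 k3⟩
      rw [Finset.cons_eq_insert, Finset.insert_subset_iff]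
      exact ⟨Finset.mem_union_left _ h1, k1.trans Finset.subset_union_right⟩
  obtain ⟨K, h1, h2, h3⟩ := key I.1 I.2 subset_rfl
  exact hI (by rwa [Subtype.ext (h1.antisymm h2)])

open Classical in
/-- The family with a given subgroup `N` at the index `i`, the whole group at the other elements of
`I`, and the trivial subgroup outside `I`. -/
noncomputable def pivotFamily {G : Type*} [Group G] (N : Subgroup G) {k : ℕ} (i : Fin k)
    (I : NonemptySubset k) (j : Fin k) : Subgroup G :=
  if j = i then N else if j ∈ I.1 then ⊤ else ⊥

theorem familyInter_pivotFamily_fg_iff {G : Type*} [Group G] [Group.FG G] {N : Subgroup G}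
    (hN : ¬ N.FG) {k : ℕ} {i : Fin k} {I : NonemptySubset k} (hi : i ∈ I.1)
    (J : NonemptySubset k) :
    (familyInter (pivotFamily N i I) J).FG ↔ ¬ (i ∈ J.1 ∧ J.1 ⊆ I.1) := by
  by_cases hJI : J.1 ⊆ I.1
  · by_cases hiJ : i ∈ J.1
    · have : familyInter (pivotFamily N i I) J = N := by
        refine le_antisymm ((iInf₂_le i hiJ).trans (by simp [pivotFamily])) (le_iInf₂ fun j hj => ?_)
        unfold pivotFamily
        split_ifs with h1 h2
        exacts [le_rfl, le_top, absurd (hJI hj) h2]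
      simp [this, hN, hiJ, hJI]
    · have : familyInter (pivotFamily N i I) J = ⊤ := by
        refine top_le_iff.1 (le_iInf₂ fun j hj => ?_)
        have hji : j ≠ i := fun h => hiJ (h ▸ hj)
        simp [pivotFamily, hji, hJI hj]
      rw [this]
      exact iff_of_true (Group.fg_def.1 inferInstance) fun h => hiJ h.1
  · obtain ⟨j, hj, hjI⟩ := Finset.not_subset.1 hJI
    have : familyInter (pivotFamily N i I) J = ⊥ := by
      have hji : j ≠ i := fun h => hjI (h ▸ hi)
      exact le_bot_iff.1 ((iInf₂_le j hj).trans (by simp [pivotFamily, hji, hjI]))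
    rw [this]
    exact iff_of_true Subgroup.FG.bot fun h => hJI h.2

theorem Configuration.IsRealizable.isHowson {α : Type*} [Finite α] {k : ℕ} {c : Configuration k}
    (hc : c.IsRealizable (FreeGroup α)) : c.IsHowson := by
  classical
  obtain ⟨H, rfl⟩ := hc
  intro I J hI hJ
  rw [intersectionConfiguration_eq_zero_iff] at hI hJ ⊢
  rw [familyInter_union]
  exact hI.inf_of_freeGroup hJ

theorem Configuration.IsHowson.isRealizable {α : Type*} [Finite α] {a b : α} (hab : a ≠ b) {k : ℕ}
    {c : Configuration k} (hc : c.IsHowson) : c.IsRealizable (FreeGroup α) := by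
  -- One free factor for each pair `(i, I)` whose configuration is bounded by `c`.
  let T := {p : Fin k × NonemptySubset k // p.1 ∈ p.2.1 ∧
    ∀ J : NonemptySubset k, p.1 ∈ J.1 → J.1 ⊆ p.2.1 → c J ≠ 0}
  obtain ⟨f, hf⟩ := FreeGroup.exists_injective_coprodI_hom hab T α
  refine Configuration.IsRealizable.of_injective ?_ hf
  refine ⟨fun j => freeProd fun t : T =>
    pivotFamily (FreeGroup.conjHom a b).range t.1.1 t.1.2 j, ?_⟩
  rw [intersectionConfiguration_eq_iff]
  intro J
  rw [familyInter, ← freeProd_iInf, freeProd_fg_iff]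
  change (∀ t : T, (familyInter (pivotFamily (FreeGroup.conjHom a b).range t.1.1 t.1.2) J).FG) ↔ _
  simp only [fun t : T =>
    familyInter_pivotFamily_fg_iff (FreeGroup.not_fg_range_conjHom hab) t.2.1 J]
  constructor
  · intro h
    by_contra hJ
    obtain ⟨i, hi, hiJ⟩ := hc.exists_pivot hJ
    exact h ⟨(i, J), hi, hiJ⟩ ⟨hi, subset_rfl⟩
  · exact fun hJ t h => t.2.2 J h.1 h.2 hJ

theorem mainTheorem1 (n : ℕ) (hn : 2 ≤ n) (k : ℕ) (hk : 1 ≤ k) (c : Configuration k) :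
    c.IsRealizable (FreeGroup (Fin n)) ↔ c.IsHowson := by
  refine ⟨fun h => h.isHowson, fun h => h.isRealizable (a := ⟨0, by lia⟩) (b := ⟨1, by lia⟩) ?_⟩
  simp
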